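/- Setting. Let $K\ge 1$, $E,Q_1,\dots,Q_K\ge 0$ be integers, $Q=\sum_k Q_k$, let $J_k:\mathbb R^{Q_k}\to\mathbb R$ and $B_k\in\mathbb R^{E\times Q_k}$ for $k=1,\dots,K$, and let $g:\mathbb R^E\to\mathbb R\cup\{+\infty\}$. For $w=\mathrm{col}\{w_1,\dots,w_K\}\in\mathbb R^Q$ put $\mathcal J(w)=\sum_{k=1}^K J_k(w_k)$, and let $B=[B_1\ \cdots\ B_K]$ and $\mathcal B_d=\mathrm{blkdiag}\{B_1,\dots,B_K\}$. Let $g^*(v)=\sup_x\,(v^\top x-g(x))$ be the conjugate of $g$, and for $\mathsf y=\mathrm{col}\{y_1,\dots,y_K\}\in\mathbb R^{EK}$ let $\mathcal G^*(\mathsf y)=\frac1K\sum_{k=1}^K g^*(y_k)$. For $\mu>0$ let $\mathrm{prox}_{\mu f}(x)=\arg\min_u f(u)+\frac1{2\mu}\|x-u\|^2$. Assume: (i) the problem $\min_w \mathcal J(w)+g(Bw)$ has a solution; $\mathcal J$ is differentiable, and for some $0<\nu\le\delta$ and all $u,v$ one has $\|\nabla\mathcal J(u)-\nabla\mathcal J(v)\|\le\delta\|u-v\|$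 and $(u-v)^\top(\nabla\mathcal J(u)-\nabla\mathcal J(v))\ge\nu\|u-v\|^2$; $g$ is proper, lower semicontinuous and convex; and there is $w$ such that $Bw$ lies in the relative interior of the domain of $g$. (ii) $\bar A\in\mathbb R^{K\times K}$ is a primitive symmetric doubly stochastic matrix and $\bar{\mathcal A}=\bar A\otimes I_E$; $\mathcal L\in\mathbb R^{EK\times EK}$ is symmetric, $\mathcal L\mathsf y=0$ if and only if $y_1=\cdots=y_K$, and $0<I-\mathcal L^2$, $\bar{\mathcal A}^2\le I-\mathcal L^2$ (in the order of symmetric matrices). (iii) $\mu_w>0$ and $\mu_y>0$. Consider the iteration $$\begin{aligned} w_i&=w_{i-1}-\mu_w\nabla\mathcal J(w_{i-1})-\mu_w\mathcal B_d^\top \mathsf y_{i-1},\\ \mathsf z_i&=\mathsf y_{i-1}+\mu_y\mathcal B_d w_i+\mathcal L\mathsf x_{i-1},\\ \mathsf x_i&=\mathsf x_{i-1}-\mathcal L\mathsf z_i,\\ \mathsf y_i&=\mathrm{prox}_{\mu_y\mathcal G^*}(\bar{\mathcal A}\mathsf z_i).\end{aligned}$$ Lemma (Fixed Point). The iteration has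 a fixed point $(w^o,\mathsf x^o,\mathsf y^o,\mathsf z^o)$, where being a fixed point is equivalent to $$0=\nabla\mathcal J(w^o)+\mathcal B_d^\top\mathsf y^o,\qquad \mathsf z^o=\mathsf y^o+\mu_y\mathcal B_d w^o+\mathcal L\mathsf x^o,\qquad 0=\mathcal L\mathsf z^o,\qquad \mathsf y^o=\mathrm{prox}_{\mu_y\mathcal G^*}(\bar{\mathcal A}\mathsf z^o).$$ Moreover, for every fixed point $(w^o,\mathsf x^o,\mathsf y^o,\mathsf z^o)$ there is $y^o\in\mathbb R^E$ such that $\mathsf y^o=\mathbf 1_K\otimes y^o$ and $(w^o,y^o)$ satisfies the centralized optimality conditions $$-B^\top y^o=\nabla\mathcal J(w^o),\qquad Bw^o\in\partial g^*(y^o).$$ -/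

import Mathlib

open scoped Gradient RealInnerProductSpace Kronecker

noncomputable section

namespace Sharing

/-! ### Convex analysis for functions with values in the extended reals -/

section ConvexAnalysis

variable {V : Type*} [NormedAddCommGroup V] [InnerProductSpace ℝ V]

/-- The effective domain `{x | f x < +∞}`. -/
def effDom (f : V → EReal) : Set V := {x | f x < ⊤}

/-- Proper: never `-∞`, and not identically `+∞`. -/
def IsProper (f : V → EReal) : Prop := (∀ x, f x ≠ ⊥) ∧ ∃ x, f x ≠ ⊤

/-- Convexity of an extended-real-valued function: its epigraph is convex. -/
def IsConvex (f : V → EReal) : Prop :=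
  Convex ℝ {p : V × ℝ | f p.1 ≤ (p.2 : EReal)}

/-- The conjugate `f*(v) = sup_x ⟨v, x⟩ - f x`. -/
def conjugate (f : V → EReal) (v : V) : EReal :=
  ⨆ x : V, ((⟪v, x⟫ : ℝ) : EReal) - f x

/-- The set of all subgradients of `f` at `x`. -/
def subdifferential (f : V → EReal) (x : V) : Set V :=
  {s | ∀ u, f x + ((⟪s, u - x⟫ : ℝ) : EReal) ≤ f u}

/-- `argmin_u f u + (1 / (2 μ)) ‖x - u‖²`, as a set. -/
def proxSet (f : V → EReal) (μ : ℝ) (x : V) : Set V :=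
  {p | ∀ u, f p + ((1 / (2 * μ) * ‖x - p‖ ^ 2 : ℝ) : EReal)
      ≤ f u + ((1 / (2 * μ) * ‖x - u‖ ^ 2 : ℝ) : EReal)}

/-- `y = prox_{μ f}(x)`: the point `y` is the minimizer defining the proximal operator. -/
def IsProx (f : V → EReal) (μ : ℝ) (x y : V) : Prop := proxSet f μ x = {y}

end ConvexAnalysis

/-! ### The sharing problem -/

/-- The data of the sharing problem
`min ∑ k, J k (w k) + g (∑ k, B k (w k))` with `K` agents, `w k ∈ ℝ^(Q k)`. -/
structure Problem (K E : ℕ) (Q : Fin K → ℕ) where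
  /-- the local costs -/
  J : (k : Fin K) → EuclideanSpace ℝ (Fin (Q k)) → ℝ
  /-- the local coupling matrices -/
  B : (k : Fin K) → Matrix (Fin E) (Fin (Q k)) ℝ
  /-- the coupling function, with values in `ℝ ∪ {+∞}` once it is proper -/
  g : EuclideanSpace ℝ (Fin E) → EReal

/-- The space of stacked primal vectors `col {w_1, …, w_K} ∈ ℝ^Q`, `Q = ∑ k, Q k`. -/
abbrev Primal {K : ℕ} (Q : Fin K → ℕ) : Type := EuclideanSpace ℝ ((k : Fin K) × Fin (Q k))

/-- The space `ℝ^E` of a single dual vector. -/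
abbrev Dual (E : ℕ) : Type := EuclideanSpace ℝ (Fin E)

/-- The space of stacked dual vectors `col {y_1, …, y_K} ∈ ℝ^(EK)`. -/
abbrev NetDual (K E : ℕ) : Type := EuclideanSpace ℝ (Fin K × Fin E)

/-- The block `w_k` of a stacked primal vector. -/
def primalBlock {K : ℕ} {Q : Fin K → ℕ} (w : Primal Q) (k : Fin K) :
    EuclideanSpace ℝ (Fin (Q k)) :=
  WithLp.toLp 2 fun q => w ⟨k, q⟩

/-- The block `y_k` of a stacked dual vector. -/
def dualBlock {K E : ℕ} (y : NetDual K E) (k : Fin K) : Dual E :=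
  WithLp.toLp 2 fun e => y (k, e)

/-- The consensual vector `1_K ⊗ y`. -/
def onesKron (K : ℕ) {E : ℕ} (y : Dual E) : NetDual K E :=
  WithLp.toLp 2 fun i => y i.2

namespace Problem

variable {K E : ℕ} {Q : Fin K → ℕ} (P : Problem K E Q)

/-- `𝒥(w) = ∑ k, J k (w k)`. -/
def cost (w : Primal Q) : ℝ := ∑ k, P.J k (primalBlock w k)

/-- `B = [B_1 ⋯ B_K]`. -/
def rowB : Matrix (Fin E) ((k : Fin K) × Fin (Q k)) ℝ :=
  Matrix.of fun e i => P.B i.1 e i.2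

/-- `B_d = blkdiag {B_1, …, B_K}`. -/
def diagB : Matrix (Fin K × Fin E) ((k : Fin K) × Fin (Q k)) ℝ :=
  Matrix.of fun r i => if r.1 = i.1 then P.B i.1 r.2 i.2 else 0

/-- The centralized objective `𝒥(w) + g (B w)`. -/
def objective (w : Primal Q) : EReal :=
  ((P.cost w : ℝ) : EReal) + P.g (P.rowB.toEuclideanLin w)

/-- `𝒢*(y) = (1 / K) ∑ k, g*(y_k)`. -/
def netConj (y : NetDual K E) : EReal :=
  ((1 / (K : ℝ) : ℝ) : EReal) * ∑ k, conjugate P.g (dualBlock y k)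

/-- The standing assumption on the objective functions. -/
structure ObjectiveAssumption (δ ν : ℝ) : Prop where
  exists_solution : ∃ w, ∀ u, P.objective w ≤ P.objective u
  nu_pos : 0 < ν
  nu_le : ν ≤ δ
  differentiable : Differentiable ℝ P.cost
  smooth : ∀ u v, ‖∇ P.cost u - ∇ P.cost v‖ ≤ δ * ‖u - v‖
  strongly_convex : ∀ u v, ν * ‖u - v‖ ^ 2 ≤ ⟪u - v, ∇ P.cost u - ∇ P.cost v⟫
  proper : IsProper P.g
  lsc : LowerSemicontinuous P.g
  convex : IsConvex P.g
  qualification : ∃ w, P.rowB.toEuclideanLin w ∈ intrinsicInterior ℝ (effDom P.g)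

/-- The optimality conditions of the centralized saddle-point problem:
`-Bᵀ y = ∇𝒥(w)` and `B w ∈ ∂g*(y)`. -/
def KKT (w : Primal Q) (y : Dual E) : Prop :=
  -(P.rowB.transpose.toEuclideanLin y) = ∇ P.cost w ∧
    P.rowB.toEuclideanLin w ∈ subdifferential (conjugate P.g) y

end Problem

/-- The extended combination matrix `Ā ⊗ I_E`. -/
def extMatrix {K : ℕ} (E : ℕ) (A : Matrix (Fin K) (Fin K) ℝ) :
    Matrix (Fin K × Fin E) (Fin K × Fin E) ℝ :=
  A ⊗ₖ (1 : Matrix (Fin E) (Fin E) ℝ)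

/-- The standing assumption on the combination matrices `Ā` and `ℒ`. The last two fields are
`0 < I - ℒ²` and `(Ā ⊗ I)² ≤ I - ℒ²` in the Loewner order. -/
structure CombinationAssumption {K E : ℕ} (A : Matrix (Fin K) (Fin K) ℝ)
    (L : Matrix (Fin K × Fin E) (Fin K × Fin E) ℝ) : Prop where
  primitive : A.IsPrimitive
  symm : A.IsSymm
  doubly_stochastic : A ∈ doublyStochastic ℝ (Fin K)
  L_symm : L.IsSymm
  consensus : ∀ y : NetDual K E,
    L.toEuclideanLin y = 0 ↔ ∀ k l, dualBlock y k = dualBlock y l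
  posDef : (1 - L ^ 2).PosDef
  loewner : (1 - L ^ 2 - extMatrix E A ^ 2).PosSemidef

/-- A state `(w, x, y, z)` of the decentralized iteration. -/
structure State {K : ℕ} (E : ℕ) (Q : Fin K → ℕ) where
  w : Primal Q
  x : NetDual K E
  y : NetDual K E
  z : NetDual K E

section Algorithm

variable {K E : ℕ} {Q : Fin K → ℕ} (P : Problem K E Q)
  (A : Matrix (Fin K) (Fin K) ℝ) (L : Matrix (Fin K × Fin E) (Fin K × Fin E) ℝ) (μw μy : ℝ)

/-- One step of the decentralized iteration leads from the state `s` to the state `t`. -/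
structure IsStep (s t : State E Q) : Prop where
  w_update : t.w = s.w - μw • ∇ P.cost s.w - μw • P.diagB.transpose.toEuclideanLin s.y
  z_update : t.z = s.y + μy • P.diagB.toEuclideanLin t.w + L.toEuclideanLin s.x
  x_update : t.x = s.x - L.toEuclideanLin t.z
  y_update : IsProx P.netConj μy ((extMatrix E A).toEuclideanLin t.z) t.y

/-- A fixed point of the decentralized iteration. -/
def IsFixedPoint (s : State E Q) : Prop := IsStep P A L μw μy s s

/-- The system of equations that describes the fixed points. -/
structure FixedPointSystem (s : State E Q) : Prop where
  w_eq : 0 = ∇ P.cost s.w + P.diagB.transpose.toEuclideanLin s.y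
  z_eq : s.z = s.y + μy • P.diagB.toEuclideanLin s.w + L.toEuclideanLin s.x
  x_eq : 0 = L.toEuclideanLin s.z
  y_eq : IsProx P.netConj μy ((extMatrix E A).toEuclideanLin s.z) s.y

end Algorithm

end Sharing

end

/-! Existence. At a primal solution `w`, Fermat's rule makes `-∇𝒥(w)` a subgradient of `g ∘ B`. The
relative interior qualification gives the chain rule `IsConvex.exists_subgradient_of_comp`, so
`-∇𝒥(w) = Bᵀ y` with `y ∈ ∂g(B w)`, and Fenchel's equality inverts this to `B w ∈ ∂g*(y)`. Put `z =
y + (μy / K) B w`. The residual `1 ⊗ z - 1 ⊗ y - μy B_d w` has block sum zero. Since `ℒ` is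
symmetric with the consensual vectors as kernel, its range is exactly the vectors of zero block sum,
so the residual equals `ℒ x` for some `x`. The prox equation at `1 ⊗ z` is the inclusion `B w ∈
∂g*(y)`.

Conversely, `ℒ z = 0` makes `z` consensual, and `Ā ⊗ I` fixes it because the rows of `Ā` sum to one.
The prox objective is then invariant under permutations of blocks, so its unique minimizer is
consensual. Summing the `z`-equation over blocks removes `ℒ x` and gives `K (z - y) = μy B w`;
optimality in the prox turns this into `B w ∈ ∂g*(y)`. -/

namespace Sharing

/-! ### Separation over a subspace, by M. Riesz extension. -/

section LinearSeparation

variable {V : Type*} [AddCommGroup V] [Module ℝ V]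

/-- The cone generated by a convex set that contains the origin. -/
def generatedCone (C : Set V) (hC : Convex ℝ C) (h0 : (0 : V) ∈ C) : PointedCone ℝ V where
  carrier := {p | ∃ c : ℝ, 0 < c ∧ c • p ∈ C}
  zero_mem' := ⟨1, one_pos, by simpa using h0⟩
  add_mem' := by
    rintro p q ⟨c, hc, hp⟩ ⟨d, hd, hq⟩
    have hcd : 0 < c + d := add_pos hc hd
    refine ⟨c * d / (c + d), by positivity, ?_⟩
    have := hC hp hq (a := d / (c + d)) (b := c / (c + d)) (by positivity) (by positivity)
      (by field_simp; ring)
    convert this using 1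
    rw [smul_add, smul_smul, smul_smul]
    congr 2 <;> ring
  smul_mem' := by
    rintro ⟨t, ht⟩ p ⟨c, hc, hp⟩
    rcases ht.eq_or_lt with rfl | ht
    · exact ⟨1, one_pos, by simpa [Nonneg.mk_smul] using h0⟩
    · refine ⟨c / t, by positivity, ?_⟩
      rw [Nonneg.mk_smul, smul_smul, div_mul_cancel₀ _ ht.ne']
      exact hp

/-- A convex set in `V × ℝ` that lies above `0` over the subspace `M` lies above a linear
functional vanishing on `M`, if some point of `M` is in the algebraic relative interior of its
projection to `V`. -/
theorem exists_linear_minorant (C : Set (V × ℝ)) (hC : Convex ℝ C) (h0 : (0 : V × ℝ) ∈ C)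
    (M S : Submodule ℝ V) (hM : ∀ x r, (x, r) ∈ C → x ∈ M → 0 ≤ r)
    (hS : ∀ x r, (x, r) ∈ C → x ∈ S)
    (hq : ∃ a ∈ M, ∀ v ∈ S, ∃ ε : ℝ, 0 < ε ∧ ∃ r, (a + ε • v, r) ∈ C) :
    ∃ l : V →ₗ[ℝ] ℝ, (∀ m ∈ M, l m = 0) ∧ ∀ x r, (x, r) ∈ C → l x ≤ r := by
  -- Directions outside `M ⊔ S` never meet `C`. Adding a complement `N` to the initial domain, where
  -- the functional is `(x, r) ↦ r`, makes the domain plus the cone cover the whole space.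
  obtain ⟨N, hN⟩ := (M ⊔ S).exists_isCompl
  obtain ⟨F, hF, hFC⟩ := riesz_extension (generatedCone C hC h0)
    ⟨(M ⊔ N).prod ⊤, (LinearMap.snd ℝ V ℝ).comp ((M ⊔ N).prod ⊤).subtype⟩
    (by
      rintro ⟨⟨x, r⟩, hx⟩ ⟨c, hc, hp⟩
      change 0 ≤ r
      have hxMN : x ∈ M ⊔ N := hx.1
      obtain ⟨m, hm, n, hn, rfl⟩ := Submodule.mem_sup.1 hxMN
      have h1 : m + n ∈ S := (S.smul_mem_iff hc.ne').1 (hS _ _ hp)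
      have h2 : n ∈ M ⊔ S := by
        have := (M ⊔ S).sub_mem (Submodule.mem_sup_right h1) (Submodule.mem_sup_left hm)
        simpa using this
      have h3 : n = 0 := Submodule.disjoint_def.1 hN.disjoint n h2 hn
      have h4 := hM _ _ hp (by simpa [h3] using M.smul_mem c hm)
      exact nonneg_of_mul_nonneg_right h4 hc)
    (by
      rintro ⟨v, r⟩
      have hv : v ∈ (M ⊔ S) ⊔ N := by rw [hN.sup_eq_top]; trivial
      obtain ⟨u, hu, n, hn, rfl⟩ := Submodule.mem_sup.1 hv
      obtain ⟨m, hm, s, hs, rfl⟩ := Submodule.mem_sup.1 hu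
      obtain ⟨a, ha, hqa⟩ := hq
      obtain ⟨ε, hε, r', hr'⟩ := hqa s hs
      refine ⟨⟨((ε⁻¹ • a - m) - n, ε⁻¹ * r' - r), ?_, trivial⟩, ε, hε, ?_⟩
      · exact (M ⊔ N).sub_mem (Submodule.mem_sup_left (M.sub_mem (M.smul_mem _ ha) hm))
          (Submodule.mem_sup_right hn)
      · convert hr' using 1
        refine Prod.ext ?_ ?_
        · change ε • ((ε⁻¹ • a - m) - n + (m + s + n)) = a + ε • s
          rw [show (ε⁻¹ • a - m) - n + (m + s + n) = ε⁻¹ • a + s by abel, smul_add, smul_smul,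
            mul_inv_cancel₀ hε.ne', one_smul]
        · change ε * (ε⁻¹ * r' - r + r) = r'
          field_simp
          ring)
  -- On `C`, `0 ≤ F (x, r) = F (x, 0) + r`, so `-F (·, 0)` is the minorant.
  refine ⟨-(F.comp (LinearMap.inl ℝ V ℝ)), fun m hm => ?_, fun x r hx => ?_⟩
  · have := hF ⟨(m, 0), Submodule.mem_sup_left hm, trivial⟩
    change F (m, 0) = 0 at this
    simpa using this
  · have h1 : F (0, r) = r := hF ⟨(0, r), Submodule.zero_mem _, trivial⟩
    have h2 : 0 ≤ F (x, r) := hFC _ ⟨1, one_pos, by simpa using hx⟩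
    have h3 : F (x, r) = F (x, 0) + F (0, r) := by rw [← map_add]; simp
    have : (-(F.comp (LinearMap.inl ℝ V ℝ))) x = -F (x, 0) := rfl
    linarith

end LinearSeparation

/-! ### Conjugates, subgradients and the chain rule. -/

section ConvexAnalysis

variable {V W : Type*} [NormedAddCommGroup V] [InnerProductSpace ℝ V]
  [NormedAddCommGroup W] [InnerProductSpace ℝ W]

theorem IsConvex.le_of_le {f : V → EReal} (hf : IsConvex f) {x y : V} {a b s t : ℝ}
    (hx : f x ≤ a) (hy : f y ≤ b) (hs : 0 ≤ s) (ht : 0 ≤ t) (hst : s + t = 1) :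
    f (s • x + t • y) ≤ ((s * a + t * b : ℝ) : EReal) :=
  hf (x := (x, a)) hx (y := (y, b)) hy hs ht hst

theorem IsConvex.comp_linearMap {f : W → EReal} (hf : IsConvex f) (T : V →ₗ[ℝ] W) :
    IsConvex fun x => f (T x) := by
  intro p hp q hq s t hs ht hst
  have := hf.le_of_le (x := T p.1) (y := T q.1) hp hq hs ht hst
  change f (T (s • p.1 + t • q.1)) ≤ _
  simpa using this

theorem inner_sub_le_conjugate (f : V → EReal) (v x : V) :
    ((⟪v, x⟫ : ℝ) : EReal) - f x ≤ conjugate f v :=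
  le_iSup (fun x => ((⟪v, x⟫ : ℝ) : EReal) - f x) x

theorem isConvex_conjugate (f : V → EReal) : IsConvex (conjugate f) := by
  intro p hp q hq s t hs ht hst
  change conjugate f (s • p.1 + t • q.1) ≤ ((s * p.2 + t * q.2 : ℝ) : EReal)
  refine iSup_le fun x => ?_
  have hp' : ((⟪p.1, x⟫ : ℝ) : EReal) - f x ≤ (p.2 : EReal) := (inner_sub_le_conjugate f _ x).trans hp
  have hq' : ((⟪q.1, x⟫ : ℝ) : EReal) - f x ≤ (q.2 : EReal) := (inner_sub_le_conjugate f _ x).trans hq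
  induction h : f x with
  | bot => rw [h] at hp'; simp at hp'
  | top => simp
  | coe c =>
    rw [h] at hp' hq'
    norm_cast at hp' hq' ⊢
    rw [inner_add_left, inner_smul_left, inner_smul_left]
    simp only [conj_trivial]
    have hc : c = s * c + t * c := by rw [← add_mul, hst, one_mul]
    nlinarith [mul_le_mul_of_nonneg_left hp' hs, mul_le_mul_of_nonneg_left hq' ht]

/-- The Fenchel equality. -/
theorem conjugate_eq_of_mem_subdifferential {f : V → EReal} {x s : V} {a : ℝ} (hx : f x = a)
    (hs : s ∈ subdifferential f x) : conjugate f s = ((⟪s, x⟫ - a : ℝ) : EReal) := by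
  refine le_antisymm (iSup_le fun u => ?_) ?_
  · have hu := hs u
    rw [hx] at hu
    induction h : f u with
    | bot => rw [h] at hu; norm_cast at hu
    | top => simp
    | coe c =>
      rw [h] at hu
      norm_cast at hu ⊢
      rw [inner_sub_right] at hu
      linarith
  · refine le_trans (le_of_eq ?_) (inner_sub_le_conjugate f _ x)
    rw [hx, EReal.coe_sub]

theorem mem_subdifferential_conjugate {f : V → EReal} {x s : V} {a : ℝ} (hx : f x = a)
    (hs : s ∈ subdifferential f x) : x ∈ subdifferential (conjugate f) s := by
  intro u
  rw [conjugate_eq_of_mem_subdifferential hx hs]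
  refine le_trans (le_of_eq ?_) (inner_sub_le_conjugate f _ x)
  rw [hx]
  norm_cast
  rw [inner_sub_right, real_inner_comm x s, real_inner_comm x u]
  ring

/-- First-order optimality for the sum of a convex and a differentiable function. -/
theorem IsConvex.sub_le_of_isMin {f : V → EReal} (hf : IsConvex f) {φ : V → ℝ}
    {φ' : V →L[ℝ] ℝ} {w u : V} (hφ : HasFDerivAt φ φ' w)
    (hmin : ∀ v, f w + ((φ w : ℝ) : EReal) ≤ f v + ((φ v : ℝ) : EReal))
    {a b : ℝ} (ha : f w = a) (hb : f u ≤ b) : a - b ≤ φ' (u - w) := by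
  have hline : HasDerivAt (fun t : ℝ => φ (w + t • (u - w))) (φ' (u - w)) 0 := by
    have h1 : HasDerivAt (fun t : ℝ => w + t • (u - w)) (u - w) 0 := by
      simpa using ((hasDerivAt_id (0 : ℝ)).smul_const (u - w)).const_add w
    have h2 : HasFDerivAt φ φ' (w + (0 : ℝ) • (u - w)) := by simpa using hφ
    exact h2.comp_hasDerivAt 0 h1
  have htend := hline.tendsto_slope_zero_right
  refine ge_of_tendsto htend ?_
  filter_upwards [Ioo_mem_nhdsGT (zero_lt_one' ℝ)] with t ht
  -- Convexity on the segment and minimality at `w` give `t (a - b) ≤ φ (w + t (u - w)) - φ w`; it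
  -- remains to divide by `t` and let `t → 0⁺`.
  have h1 := hf.le_of_le ha.le hb (sub_nonneg.2 ht.2.le) ht.1.le (sub_add_cancel 1 t)
  rw [show (1 - t) • w + t • u = w + t • (u - w) by
    rw [sub_smul, smul_sub, one_smul]; abel] at h1
  have h2 := (hmin (w + t • (u - w))).trans (add_le_add_left h1 _)
  rw [ha] at h2
  norm_cast at h2
  simp only [zero_add, zero_smul, add_zero, smul_eq_mul]
  rw [le_inv_mul_iff₀ ht.1]
  linarith

/-- Turns the topological qualification into the algebraic one required by `exists_linear_minorant`.
-/
theorem exists_add_smul_mem_of_mem_intrinsicInterior {D : Set V} {x v : V}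
    (hx : x ∈ intrinsicInterior ℝ D) (hv : v ∈ (affineSpan ℝ D).direction) :
    ∃ ε : ℝ, 0 < ε ∧ x + ε • v ∈ D := by
  obtain ⟨⟨y, hy⟩, hyi, rfl⟩ := mem_intrinsicInterior.1 hx
  have hmem : ∀ t : ℝ, y + t • v ∈ affineSpan ℝ D := fun t => by
    rw [add_comm]
    exact AffineSubspace.vadd_mem_of_mem_direction (Submodule.smul_mem _ t hv) hy
  let γ : ℝ → affineSpan ℝ D := fun t => ⟨y + t • v, hmem t⟩
  have hγ : Continuous γ := by
    refine Continuous.subtype_mk ?_ _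
    fun_prop
  have h0 : γ 0 = ⟨y, hy⟩ := by simp [γ]
  have hev : ∀ᶠ t in nhds (0 : ℝ), γ t ∈ ((↑) ⁻¹' D : Set (affineSpan ℝ D)) :=
    hγ.continuousAt.eventually_mem (by rw [h0]; exact mem_interior_iff_mem_nhds.1 hyi)
  have hev' := (hev.filter_mono nhdsWithin_le_nhds : ∀ᶠ t in nhdsWithin (0 : ℝ) (Set.Ioi 0),
    γ t ∈ ((↑) ⁻¹' D : Set (affineSpan ℝ D)))
  obtain ⟨ε, h1, h2⟩ := (hev'.and self_mem_nhdsWithin).exists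
  exact ⟨ε, h2, h1⟩

variable [FiniteDimensional ℝ V] [FiniteDimensional ℝ W]

/-- The chain rule for the subdifferential of `f ∘ T` under a relative interior qualification. -/
theorem IsConvex.exists_subgradient_of_comp {f : W → EReal} (hf : IsConvex f) (T : V →ₗ[ℝ] W)
    (hq : ∃ v, T v ∈ intrinsicInterior ℝ (effDom f)) {w p : V} {a : ℝ} (ha : f (T w) = a)
    (hp : p ∈ subdifferential (fun v => f (T v)) w) :
    ∃ y ∈ subdifferential f (T w), T.adjoint y = p := by
  -- `f ∘ T` is constant along `T.ker` through `w`, so its subgradient `p` is orthogonal to `T.ker`.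
  have hpq : p ∈ T.adjoint.range := by
    rw [← LinearMap.orthogonal_ker, Submodule.mem_orthogonal]
    intro u hu
    have key : ∀ v : V, v ∈ T.ker → ⟪v, p⟫ ≤ 0 := fun v hv => by
      have := hp (w + v)
      simp only [map_add, LinearMap.mem_ker.1 hv, add_zero, ha, add_sub_cancel_left] at this
      norm_cast at this
      rw [real_inner_comm]
      linarith
    have h2 := key (-u) (neg_mem hu)
    rw [inner_neg_left] at h2
    exact le_antisymm (key u hu) (by linarith)
  obtain ⟨q, rfl⟩ := hpq
  obtain ⟨v₀, hv₀⟩ := hq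
  have hTw : T w ∈ effDom f := by change f (T w) < ⊤; rw [ha]; exact EReal.coe_lt_top a
  -- The set is the epigraph of `x ↦ f (T w + x) - a - ⟪q, x⟫`, nonnegative on `T.range`. The
  -- minorant corrects `q` to a subgradient of `f`, and its vanishing on `T.range` leaves `T.adjoint
  -- q` unchanged.
  obtain ⟨l, hlM, hlC⟩ := exists_linear_minorant
    {x : W × ℝ | f (T w + x.1) ≤ ((a + ⟪q, x.1⟫ + x.2 : ℝ) : EReal)}
    (by
      rintro ⟨x, r⟩ hx ⟨x', r'⟩ hx' s t hs ht hst
      have := hf.le_of_le (show f (T w + x) ≤ _ from hx) (show f (T w + x') ≤ _ from hx')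
        hs ht hst
      change f (T w + (s • x + t • x')) ≤ ((a + ⟪q, s • x + t • x'⟫ + (s * r + t * r') : ℝ) : EReal)
      convert this using 2
      · rw [show T w + (s • x + t • x') = (s + t) • T w + (s • x + t • x') by
          rw [hst, one_smul]]
        simp only [smul_add, add_smul]; abel
      · rw [inner_add_right, inner_smul_right, inner_smul_right,
          show a = (s + t) * a by rw [hst, one_mul]]
        rw [hst]; ring_nf
        rw [show t = 1 - s by linarith]; ring)
    (by simp [ha])
    T.range (affineSpan ℝ (effDom f)).direction
    (by
      rintro x r hx ⟨u, rfl⟩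
      have h1 := hp (w + u)
      simp only [map_add] at h1
      have h2 := h1.trans hx
      simp only [add_sub_cancel_left, ha, LinearMap.adjoint_inner_left] at h2
      norm_cast at h2
      linarith)
    (fun x r hx => by
      have h1 : T w + x ∈ effDom f := lt_of_le_of_lt hx (EReal.coe_lt_top _)
      have := AffineSubspace.vsub_mem_direction (mem_affineSpan ℝ h1) (mem_affineSpan ℝ hTw)
      simpa using this)
    (by
      refine ⟨T (v₀ - w), ⟨_, rfl⟩, fun v hv => ?_⟩
      obtain ⟨ε, hε, hmem⟩ := exists_add_smul_mem_of_mem_intrinsicInterior hv₀ hv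
      refine ⟨ε, hε, (f (T v₀ + ε • v)).toReal - a - ⟪q, T (v₀ - w) + ε • v⟫, ?_⟩
      have h1 : f (T v₀ + ε • v) ≤ ((f (T v₀ + ε • v)).toReal : EReal) :=
        EReal.le_coe_toReal (ne_of_lt hmem)
      change f (T w + (T (v₀ - w) + ε • v)) ≤ _
      convert h1 using 2
      · rw [map_sub]; abel
      · ring)
  obtain ⟨z, hz⟩ : ∃ z : W, ∀ x, ⟪z, x⟫ = l x :=
    ⟨(InnerProductSpace.toDual ℝ W).symm l.toContinuousLinearMap, fun x => by simp⟩
  refine ⟨q + z, fun u => ?_, ?_⟩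
  · rw [ha]
    induction h : f u with
    | bot =>
      exfalso
      have key : ∀ r : ℝ, l (u - T w) ≤ r := fun r => hlC _ _ (by
        change f (T w + (u - T w)) ≤ _
        rw [add_sub_cancel, h]; exact bot_le)
      have := key (l (u - T w) - 1)
      linarith
    | top => exact le_top
    | coe c =>
      have := hlC (u - T w) (c - a - ⟪q, u - T w⟫) (by
        change f (T w + (u - T w)) ≤ _
        rw [add_sub_cancel, h]
        exact EReal.coe_le_coe_iff.2 (by simp))
      norm_cast
      rw [inner_add_left, hz]
      linarith
  · rw [map_add, add_eq_left]
    refine ext_inner_right ℝ fun v => ?_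
    rw [LinearMap.adjoint_inner_left, hz, inner_zero_left]
    exact hlM _ ⟨v, rfl⟩

end ConvexAnalysis

/-! ### Block sums and consensual vectors. -/

section Blocks

variable {K E : ℕ} {Q : Fin K → ℕ}

@[simp] theorem dualBlock_apply (y : NetDual K E) (k : Fin K) (e : Fin E) :
    dualBlock y k e = y (k, e) := rfl

@[simp] theorem onesKron_apply (y : Dual E) (i : Fin K × Fin E) :
    onesKron K y i = y i.2 := rfl

@[simp] theorem dualBlock_onesKron (y : Dual E) (k : Fin K) :
    dualBlock (onesKron K y) k = y := rfl

@[simp] theorem dualBlock_sub (x y : NetDual K E) (k : Fin K) :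
    dualBlock (x - y) k = dualBlock x k - dualBlock y k := rfl

theorem eq_onesKron_of_consensus (k₀ : Fin K) {y : NetDual K E}
    (hy : ∀ k l, dualBlock y k = dualBlock y l) : y = onesKron K (dualBlock y k₀) := by
  ext ⟨k, e⟩
  exact congrArg (fun u : Dual E => u e) (hy k k₀)

theorem inner_eq_sum_dualBlock (x y : NetDual K E) :
    ⟪x, y⟫ = ∑ k, ⟪dualBlock x k, dualBlock y k⟫ := by
  simp only [PiLp.inner_apply, Fintype.sum_prod_type, dualBlock_apply]

theorem norm_sq_eq_sum_dualBlock (x : NetDual K E) :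
    ‖x‖ ^ 2 = ∑ k, ‖dualBlock x k‖ ^ 2 := by
  simp only [← real_inner_self_eq_norm_sq]
  exact inner_eq_sum_dualBlock x x

theorem inner_onesKron_left (x : Dual E) (y : NetDual K E) :
    ⟪onesKron K x, y⟫ = ⟪x, ∑ k, dualBlock y k⟫ := by
  rw [inner_eq_sum_dualBlock, inner_sum]
  rfl

/-- The stacked vector with permuted blocks. -/
def permBlocks (σ : Equiv.Perm (Fin K)) (y : NetDual K E) : NetDual K E :=
  WithLp.toLp 2 fun i => y (σ i.1, i.2)

@[simp] theorem dualBlock_permBlocks (σ : Equiv.Perm (Fin K)) (y : NetDual K E) (k : Fin K) :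
    dualBlock (permBlocks σ y) k = dualBlock y (σ k) := rfl

theorem sum_dualBlock_diagB (P : Problem K E Q) (w : Primal Q) :
    ∑ k, dualBlock (P.diagB.toEuclideanLin w) k = P.rowB.toEuclideanLin w := by
  ext e
  simp only [WithLp.ofLp_sum, Finset.sum_apply, dualBlock_apply,
    Matrix.ofLp_toLpLin, Matrix.toLin'_apply, Matrix.mulVec, dotProduct,
    Problem.diagB, Problem.rowB,
    Matrix.of_apply]
  rw [Finset.sum_comm]
  refine Finset.sum_congr rfl fun i _ => ?_
  rw [← Finset.sum_mul]
  simp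

theorem diagB_transpose_onesKron (P : Problem K E Q) (y : Dual E) :
    P.diagB.transpose.toEuclideanLin (onesKron K y) = P.rowB.transpose.toEuclideanLin y := by
  ext i
  simp only [Matrix.ofLp_toLpLin, Matrix.toLin'_apply, Matrix.mulVec, dotProduct,
    Problem.diagB,
    Problem.rowB, Matrix.of_apply, Matrix.transpose_apply, Fintype.sum_prod_type, onesKron_apply]
  rw [Finset.sum_comm]
  refine Finset.sum_congr rfl fun e _ => ?_
  simp

theorem extMatrix_onesKron {A : Matrix (Fin K) (Fin K) ℝ} (hA : A ∈ doublyStochastic ℝ (Fin K))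
    (y : Dual E) : (extMatrix E A).toEuclideanLin (onesKron K y) = onesKron K y := by
  ext ⟨k, e⟩
  simp only [Matrix.ofLp_toLpLin, Matrix.toLin'_apply, Matrix.mulVec, dotProduct,
    extMatrix,
    Matrix.kroneckerMap_apply, Fintype.sum_prod_type, onesKron_apply, Matrix.one_apply]
  simp [← Finset.sum_mul, sum_row_of_mem_doublyStochastic hA k]

theorem transpose_toEuclideanLin {m n : Type*} [Fintype m] [Fintype n] [DecidableEq m]
    [DecidableEq n] (M : Matrix m n ℝ) :
    M.transpose.toEuclideanLin = M.toEuclideanLin.adjoint := by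
  rw [← Matrix.toEuclideanLin_conjTranspose_eq_adjoint,
    Matrix.conjTranspose_eq_transpose_of_trivial]

end Blocks

/-! ### Kernel and range of `ℒ`. -/

section Combination

variable {K E : ℕ} {A : Matrix (Fin K) (Fin K) ℝ}
  {L : Matrix (Fin K × Fin E) (Fin K × Fin E) ℝ}

theorem CombinationAssumption.adjoint_eq (h : CombinationAssumption A L) :
    L.toEuclideanLin.adjoint = L.toEuclideanLin := by
  rw [← transpose_toEuclideanLin, h.L_symm.eq]

theorem CombinationAssumption.apply_onesKron (h : CombinationAssumption A L) (y : Dual E) :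
    L.toEuclideanLin (onesKron K y) = 0 := (h.consensus _).2 fun _ _ => rfl

theorem CombinationAssumption.sum_dualBlock (h : CombinationAssumption A L)
    (x : NetDual K E) : ∑ k, dualBlock (L.toEuclideanLin x) k = 0 := by
  refine ext_inner_left ℝ fun v => ?_
  rw [← inner_onesKron_left, ← h.adjoint_eq, LinearMap.adjoint_inner_right, h.apply_onesKron]
  simp

/-- The range of a symmetric matrix is the orthogonal complement of its kernel; orthogonality to
every `1 ⊗ u` means zero block sum. -/
theorem CombinationAssumption.exists_eq (h : CombinationAssumption A L) (hK : 0 < K)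
    {v : NetDual K E} (hv : ∑ k, dualBlock v k = 0) : ∃ x, L.toEuclideanLin x = v := by
  have : v ∈ L.toEuclideanLin.adjoint.range := by
    rw [← LinearMap.orthogonal_ker, Submodule.mem_orthogonal]
    intro u hu
    rw [eq_onesKron_of_consensus ⟨0, hK⟩ ((h.consensus u).1 hu), inner_onesKron_left, hv,
      inner_zero_right]
  rwa [h.adjoint_eq] at this

end Combination

/-! ### The proximal operator of `𝒢*` at consensual points. -/

section NetworkConjugate

variable {K E : ℕ} {Q : Fin K → ℕ} (P : Problem K E Q)

theorem netConj_permBlocks (σ : Equiv.Perm (Fin K)) (y : NetDual K E) :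
    P.netConj (permBlocks σ y) = P.netConj y := by
  unfold Problem.netConj
  simp only [dualBlock_permBlocks]
  rw [Equiv.sum_comp σ fun k => conjugate P.g (dualBlock y k)]

theorem ereal_coe_sum {ι : Type*} (s : Finset ι) (f : ι → ℝ) :
    ((∑ i ∈ s, f i : ℝ) : EReal) = ∑ i ∈ s, (f i : EReal) :=
  map_sum (⟨⟨Real.toEReal, EReal.coe_zero⟩, EReal.coe_add⟩ : ℝ →+ EReal) f s

theorem netConj_onesKron (hK : 0 < K) (y : Dual E) :
    P.netConj (onesKron K y) = conjugate P.g y := by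
  have hK' : (0 : ℝ) < K := by exact_mod_cast hK
  unfold Problem.netConj
  simp only [dualBlock_onesKron, Finset.sum_const, Finset.card_univ, Fintype.card_fin,
    EReal.nsmul_eq_mul]
  rw [← mul_assoc, ← EReal.coe_coe_eq_natCast, ← EReal.coe_mul, one_div,
    inv_mul_cancel₀ hK'.ne', EReal.coe_one, one_mul]

/-- The subgradient inequality for the network conjugate at a consensual point. -/
theorem le_netConj (hK : 0 < K) {y s : Dual E} {c : ℝ} (hc : conjugate P.g y = c)
    (hs : s ∈ subdifferential (conjugate P.g) y) (u : NetDual K E) :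
    ((c + 1 / (K : ℝ) * ⟪onesKron K s, u - onesKron K y⟫ : ℝ) : EReal) ≤ P.netConj u := by
  have hK' : (0 : ℝ) < K := by exact_mod_cast hK
  have h1 : ((∑ k, (c + ⟪s, dualBlock u k - y⟫) : ℝ) : EReal) ≤
      ∑ k, conjugate P.g (dualBlock u k) := by
    rw [ereal_coe_sum]
    refine Finset.sum_le_sum fun k _ => ?_
    have := hs (dualBlock u k)
    rw [hc] at this
    exact_mod_cast this
  unfold Problem.netConj
  refine le_trans (le_of_eq ?_) (mul_le_mul_of_nonneg_left h1
    (EReal.coe_nonneg.2 (by positivity)))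
  rw [← EReal.coe_mul, inner_eq_sum_dualBlock, Finset.sum_add_distrib]
  congr 1
  simp only [dualBlock_sub, dualBlock_onesKron, Finset.sum_const, Finset.card_univ,
    Fintype.card_fin, nsmul_eq_mul]
  field_simp

theorem isProx_onesKron (hK : 0 < K) {μ : ℝ} (hμ : 0 < μ) {y s z : Dual E} {c : ℝ}
    (hc : conjugate P.g y = c) (hs : s ∈ subdifferential (conjugate P.g) y)
    (hz : z - y = (μ / K) • s) : IsProx P.netConj μ (onesKron K z) (onesKron K y) := by
  have hK' : (0 : ℝ) < K := by exact_mod_cast hK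
  have hval : P.netConj (onesKron K y) = c := by rw [netConj_onesKron P hK, hc]
  -- Quadratic growth: when the square is expanded around `1 ⊗ y`, its cross term cancels the
  -- subgradient term because `z - y = (μ / K) s`. Both minimality and uniqueness follow.
  have key : ∀ u : NetDual K E,
      ((c + 1 / (2 * μ) * ‖onesKron K z - onesKron K y‖ ^ 2
        + 1 / (2 * μ) * ‖u - onesKron K y‖ ^ 2 : ℝ) : EReal) ≤
      P.netConj u + ((1 / (2 * μ) * ‖onesKron K z - u‖ ^ 2 : ℝ) : EReal) := fun u => by
    refine le_trans (le_of_eq ?_) (add_le_add_left (le_netConj P hK hc hs u) _)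
    rw [← EReal.coe_add]
    congr 1
    have h1 : onesKron K z - onesKron K y = (μ / K) • onesKron K s := by
      ext i; exact congrArg (fun v : Dual E => v i.2) hz
    have h2 : onesKron K z - u = (μ / K) • onesKron K s - (u - onesKron K y) := by
      rw [← h1]; abel
    rw [h2, h1, norm_sub_sq_real ((μ / (K : ℝ)) • onesKron K s), inner_smul_left]
    simp only [conj_trivial]
    field_simp
    ring
  unfold IsProx
  ext p
  constructor
  · intro hp
    have h1 := (key p).trans (hp (onesKron K y))
    rw [hval, ← EReal.coe_add, EReal.coe_le_coe_iff] at h1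
    have h2 : 1 / (2 * μ) * ‖p - onesKron K y‖ ^ 2 ≤ 0 := by linarith
    have h3 : ‖p - onesKron K y‖ ^ 2 ≤ 0 := nonpos_of_mul_nonpos_right h2 (by positivity)
    have h4 : ‖p - onesKron K y‖ = 0 := by nlinarith [norm_nonneg (p - onesKron K y)]
    exact sub_eq_zero.1 (norm_eq_zero.1 h4)
  · rintro rfl u
    refine le_trans ?_ (key u)
    rw [hval, ← EReal.coe_add, EReal.coe_le_coe_iff]
    have : 0 ≤ 1 / (2 * μ) * ‖u - onesKron K y‖ ^ 2 := by positivity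
    linarith

/-- Swapping two blocks of `y` preserves `𝒢*` and the distance to the consensual centre, so
uniqueness of the minimizer forces the blocks to agree. -/
theorem consensus_of_isProx {μ : ℝ} {z : Dual E} {y : NetDual K E}
    (h : IsProx P.netConj μ (onesKron K z) y) (k l : Fin K) :
    dualBlock y k = dualBlock y l := by
  have hy : y ∈ proxSet P.netConj μ (onesKron K z) := by rw [h]; rfl
  have hperm : permBlocks (Equiv.swap k l) y ∈ proxSet P.netConj μ (onesKron K z) := fun u => by
    refine le_trans (le_of_eq ?_) (hy u)
    rw [netConj_permBlocks, norm_sq_eq_sum_dualBlock, norm_sq_eq_sum_dualBlock]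
    simp only [dualBlock_sub, dualBlock_permBlocks, dualBlock_onesKron]
    rw [Equiv.sum_comp (Equiv.swap k l) fun j => ‖z - dualBlock y j‖ ^ 2]
  rw [h] at hperm
  have := congrArg (fun v => dualBlock v l) (Set.mem_singleton_iff.1 hperm)
  simpa using this

theorem mem_subdifferential_of_isProx (hK : 0 < K) {μ : ℝ} (hμ : 0 < μ) {z y : Dual E}
    (h : IsProx P.netConj μ (onesKron K z) (onesKron K y)) :
    ((K : ℝ) / μ) • (z - y) ∈ subdifferential (conjugate P.g) y := by
  have hy : onesKron K y ∈ proxSet P.netConj μ (onesKron K z) := by rw [h]; rfl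
  -- Only consensual competitors are needed: the `1 / K` in `𝒢*` averages out, while the square is
  -- counted `K` times.
  have hmin : ∀ u : Dual E,
      conjugate P.g y + (((K : ℝ) / (2 * μ) * ‖z - y‖ ^ 2 : ℝ) : EReal) ≤
      conjugate P.g u + (((K : ℝ) / (2 * μ) * ‖z - u‖ ^ 2 : ℝ) : EReal) := fun u => by
    have h1 := hy (onesKron K u)
    have h2 : ∀ v : Dual E, 1 / (2 * μ) * ‖onesKron K z - onesKron K v‖ ^ 2
        = (K : ℝ) / (2 * μ) * ‖z - v‖ ^ 2 := fun v => by
      rw [norm_sq_eq_sum_dualBlock]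
      simp
      ring
    rwa [netConj_onesKron P hK, netConj_onesKron P hK, h2, h2] at h1
  have hderiv : HasFDerivAt (fun u : Dual E => (K : ℝ) / (2 * μ) * ‖z - u‖ ^ 2)
      (innerSL ℝ (-(((K : ℝ) / μ) • (z - y)))) y := by
    have h1 := ((hasFDerivAt_id y).const_sub z).norm_sq.const_mul ((K : ℝ) / (2 * μ))
    refine h1.congr_fderiv ?_
    ext v
    simp
    field_simp
    ring
  intro u
  induction hcu : conjugate P.g u with
  | top => exact le_top
  -- Nothing here makes the conjugate proper. A value `⊥` at `u` forces `⊥` at the minimizer `y`,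
  -- and `⊥` absorbs in sums.
  | bot =>
    have h1 := hmin u
    rw [hcu, EReal.bot_add, le_bot_iff, EReal.add_eq_bot_iff] at h1
    rcases h1 with h1 | h1
    · rw [h1, EReal.bot_add]
    · exact absurd h1 (EReal.coe_ne_bot _)
  | coe b =>
    induction hcy : conjugate P.g y with
    | top =>
      have h1 := hmin u
      rw [hcu, hcy, EReal.top_add_coe, ← EReal.coe_add, top_le_iff] at h1
      exact absurd h1 (EReal.coe_ne_top _)
    | bot => rw [EReal.bot_add]; exact bot_le
    | coe a =>
      have h1 := (isConvex_conjugate P.g).sub_le_of_isMin hderiv hmin hcy hcu.le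
      rw [innerSL_apply_apply, inner_neg_left] at h1
      norm_cast
      linarith

end NetworkConjugate

/-! ### Existence of a centralized saddle point. -/

/-- The real number `c` records that `g*(y)` is finite, which `isProx_onesKron` needs for
uniqueness. -/
theorem Problem.ObjectiveAssumption.exists_saddle {K E : ℕ} {Q : Fin K → ℕ} {P : Problem K E Q}
    {δ ν : ℝ} (h : P.ObjectiveAssumption δ ν) :
    ∃ (w : Primal Q) (y : Dual E) (c : ℝ), P.KKT w y ∧ conjugate P.g y = c := by
  obtain ⟨w, hw⟩ := h.exists_solution
  obtain ⟨w₀, hw₀⟩ := h.qualification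
  have hfin : P.g (P.rowB.toEuclideanLin w₀) ≠ ⊤ := by
    have : P.rowB.toEuclideanLin w₀ ∈ effDom P.g := intrinsicInterior_subset hw₀
    exact ne_of_lt this
  obtain ⟨a, ha⟩ : ∃ a : ℝ, P.g (P.rowB.toEuclideanLin w) = a := by
    refine ⟨_, (EReal.coe_toReal (fun htop => ?_) (h.proper.1 _)).symm⟩
    have h1 := hw w₀
    unfold Problem.objective at h1
    rw [htop, EReal.coe_add_top, top_le_iff, ← EReal.coe_toReal hfin (h.proper.1 _),
      ← EReal.coe_add] at h1
    exact EReal.coe_ne_top _ h1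
  have hgrad := (h.differentiable w).hasGradientAt.hasFDerivAt
  have hsub : -∇ P.cost w ∈ subdifferential (fun v => P.g (P.rowB.toEuclideanLin v)) w := by
    intro u
    simp only [ha]
    induction hu : P.g (P.rowB.toEuclideanLin u) with
    | bot => exact absurd hu (h.proper.1 _)
    | top => exact le_top
    | coe b =>
      have h1 := (h.convex.comp_linearMap P.rowB.toEuclideanLin).sub_le_of_isMin hgrad
        (fun v => by simpa only [Problem.objective, add_comm] using hw v) ha hu.le
      rw [InnerProductSpace.toDual_apply_apply] at h1
      norm_cast
      rw [inner_neg_left]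
      linarith
  obtain ⟨y, hy, hyw⟩ := h.convex.exists_subgradient_of_comp P.rowB.toEuclideanLin ⟨w₀, hw₀⟩
    ha hsub
  refine ⟨w, y, _, ⟨?_, mem_subdifferential_conjugate ha hy⟩,
    conjugate_eq_of_mem_subdifferential ha hy⟩
  rw [transpose_toEuclideanLin, hyw, neg_neg]

/-! ### Fixed points and the optimality conditions. -/

section Algorithm

variable {K E : ℕ} {Q : Fin K → ℕ} {P : Problem K E Q}
  {A : Matrix (Fin K) (Fin K) ℝ} {L : Matrix (Fin K × Fin E) (Fin K × Fin E) ℝ} {μw μy : ℝ}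

theorem isFixedPoint_iff (hμw : 0 < μw) (s : State E Q) :
    IsFixedPoint P A L μw μy s ↔ FixedPointSystem P A L μy s := by
  constructor
  · rintro ⟨h1, h2, h3, h4⟩
    refine ⟨?_, h2, (sub_eq_self.1 h3.symm).symm, h4⟩
    rw [sub_sub, ← smul_add, eq_comm, sub_eq_self, smul_eq_zero] at h1
    exact (h1.resolve_left hμw.ne').symm
  · rintro ⟨h1, h2, h3, h4⟩
    refine ⟨?_, h2, by rw [← h3, sub_zero], h4⟩
    rw [sub_sub, ← smul_add, ← h1, smul_zero, sub_zero]

theorem exists_fixedPointSystem (hK : 0 < K) (hμy : 0 < μy) (hcomb : CombinationAssumption A L)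
    {w : Primal Q} {y : Dual E} {c : ℝ} (hkkt : P.KKT w y) (hc : conjugate P.g y = c) :
    ∃ s : State E Q, FixedPointSystem P A L μy s := by
  have hK' : (K : ℝ) ≠ 0 := by exact_mod_cast hK.ne'
  -- The only possible choice: the block sum of the `z`-equation reads `K z = K y + μy B w`.
  let z : Dual E := y + (μy / K) • P.rowB.toEuclideanLin w
  obtain ⟨x, hx⟩ := hcomb.exists_eq hK
    (v := onesKron K z - onesKron K y - μy • P.diagB.toEuclideanLin w) (by
      have h1 : ∀ k, dualBlock (onesKron K z - onesKron K y - μy • P.diagB.toEuclideanLin w) k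
          = (z - y) - μy • dualBlock (P.diagB.toEuclideanLin w) k := fun _ => rfl
      simp only [h1]
      rw [Finset.sum_sub_distrib, ← Finset.smul_sum, sum_dualBlock_diagB, Finset.sum_const,
        Finset.card_univ, Fintype.card_fin, add_sub_cancel_left, ← Nat.cast_smul_eq_nsmul ℝ,
        smul_smul, mul_div_cancel₀ _ hK', sub_self])
  refine ⟨⟨w, x, onesKron K y, onesKron K z⟩, ?_, ?_, (hcomb.apply_onesKron z).symm, ?_⟩
  · change 0 = ∇ P.cost w + P.diagB.transpose.toEuclideanLin (onesKron K y)
    rw [diagB_transpose_onesKron, ← hkkt.1, neg_add_cancel]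
  · change onesKron K z = onesKron K y + μy • P.diagB.toEuclideanLin w + L.toEuclideanLin x
    rw [hx]
    abel
  · change IsProx P.netConj μy ((extMatrix E A).toEuclideanLin (onesKron K z)) (onesKron K y)
    rw [extMatrix_onesKron hcomb.doubly_stochastic]
    exact isProx_onesKron P hK hμy hc hkkt.2 (add_sub_cancel_left _ _)

theorem FixedPointSystem.exists_kkt (hK : 0 < K) (hμy : 0 < μy)
    (hcomb : CombinationAssumption A L) {s : State E Q} (hs : FixedPointSystem P A L μy s) :
    ∃ y : Dual E, s.y = onesKron K y ∧ P.KKT s.w y := by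
  have hK' : (K : ℝ) ≠ 0 := by exact_mod_cast hK.ne'
  obtain ⟨z, hz⟩ : ∃ z, s.z = onesKron K z :=
    ⟨_, eq_onesKron_of_consensus ⟨0, hK⟩ ((hcomb.consensus _).1 hs.x_eq.symm)⟩
  have hprox := hs.y_eq
  rw [hz, extMatrix_onesKron hcomb.doubly_stochastic] at hprox
  obtain ⟨y, hy⟩ : ∃ y, s.y = onesKron K y :=
    ⟨_, eq_onesKron_of_consensus ⟨0, hK⟩ (consensus_of_isProx P hprox)⟩
  rw [hy] at hprox
  refine ⟨y, hy, ?_, ?_⟩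
  · have h1 := hs.w_eq
    rw [hy, diagB_transpose_onesKron] at h1
    exact neg_eq_of_add_eq_zero_left h1.symm
  · have h1 := hs.z_eq
    rw [hz, hy] at h1
    have h2 : ∀ k, z = y + μy • dualBlock (P.diagB.toEuclideanLin s.w) k
        + dualBlock (L.toEuclideanLin s.x) k := fun k => congrArg (fun v => dualBlock v k) h1
    -- Summation over blocks eliminates the unknown `ℒ x` and assembles `B w` from the local
    -- products.
    have h3 := Finset.sum_congr rfl fun k (_ : k ∈ (Finset.univ : Finset (Fin K))) => h2 k
    rw [Finset.sum_add_distrib, Finset.sum_add_distrib, hcomb.sum_dualBlock, add_zero,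
      ← Finset.smul_sum, sum_dualBlock_diagB] at h3
    simp only [Finset.sum_const, Finset.card_univ, Fintype.card_fin] at h3
    have h4 : ((K : ℝ) / μy) • (z - y) = P.rowB.toEuclideanLin s.w := by
      rw [div_eq_inv_mul, mul_smul, Nat.cast_smul_eq_nsmul, smul_sub, h3, add_sub_cancel_left,
        smul_smul, inv_mul_cancel₀ hμy.ne', one_smul]
    rw [← h4]
    exact mem_subdifferential_of_isProx P hK hμy hprox

end Algorithm

end Sharing

theorem lemma2 {K E : ℕ} (hK : 0 < K) {Q : Fin K → ℕ} (P : Sharing.Problem K E Q)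
    (A : Matrix (Fin K) (Fin K) ℝ) (L : Matrix (Fin K × Fin E) (Fin K × Fin E) ℝ)
    (δ ν μw μy : ℝ) (hμw : 0 < μw) (hμy : 0 < μy)
    (hobj : P.ObjectiveAssumption δ ν) (hcomb : Sharing.CombinationAssumption A L) :
    (∃ s : Sharing.State E Q, Sharing.IsFixedPoint P A L μw μy s) ∧
    (∀ s : Sharing.State E Q,
      Sharing.IsFixedPoint P A L μw μy s ↔ Sharing.FixedPointSystem P A L μy s) ∧
    (∀ s : Sharing.State E Q, Sharing.IsFixedPoint P A L μw μy s →
      ∃ y : Sharing.Dual E, s.y = Sharing.onesKron K y ∧ P.KKT s.w y) := by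
  refine ⟨?_, Sharing.isFixedPoint_iff hμw, fun s hs =>
    ((Sharing.isFixedPoint_iff hμw s).1 hs).exists_kkt hK hμy hcomb⟩
  obtain ⟨w, y, c, hkkt, hc⟩ := hobj.exists_saddle
  obtain ⟨s, hs⟩ := Sharing.exists_fixedPointSystem hK hμy hcomb hkkt hc
  exact ⟨s, (Sharing.isFixedPoint_iff hμw s).2 hs⟩
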